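/- Let $A\in\mathbb R^{n\times n}$, $B\in\mathbb R^{n\times m}$, $B_w\in\mathbb R^{n\times p}$, let $Q\succ0$ and $R\succ0$ be symmetric, and let $\gamma>0$. Consider the system $$\dot x(t)=Ax(t)+Bu(t)+B_ww(t),\qquad x(0)=x_0 ,$$ with closed-loop policies $u(t)=\mu(t;x(\tau),\tau\le t)$ for the control and $w(t)=\nu(t;x(\tau),\tau\le t)$ for the disturbance. Let $\mathcal M$ and $\mathcal N$ be the sets of all Borel measurable functions $\mu$, resp. $\nu$, of time and state history that are piecewise continuous in $t$ (for every continuous state path) and Lipschitz continuous in the state history $x|_{[0,t]}$ in the supremum norm, with a Lipschitz constant that is uniform over $t$ in bounded intervals. Every pair $(\mu,\nu)\in\mathcal M\times\mathcal N$ generates, for every $x_0$, exactly one continuous state trajectory on $[0,\infty)$. Put $$J_\gamma(\mu,\nu)=\int_0^\infty\bigl(x^{\mathsf T}Qx+u^{\mathsf T}Ru-\gamma^2\|w\|^2\bigr)\,dt ,$$ the improper integral with value in $[-\infty,\infty]$; for pairs $(\mu,\nu)$ for which the limit does not exist in $[-\infty,\infty]$, $J_\gamma(\mu,\nu)$ may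 be assigned any value in $[-\infty,\infty]$. Let $\underline p^\star=\sup_{\nu\in\mathcal N}\inf_{\mu\in\mathcal M}J_\gamma(\mu,\nu)$ and $\overline p^\star=\inf_{\mu\in\mathcal M}\sup_{\nu\in\mathcal N}J_\gamma(\mu,\nu)$. Assume that the algebraic Riccati equation $$A^{\mathsf T}P+PA+Q-PBR^{-1}B^{\mathsf T}P+\tfrac1{\gamma^2}PB_wB_w^{\mathsf T}P=0$$ has a symmetric solution $P^\star\succeq0$ such that all eigenvalues of $A-BR^{-1}B^{\mathsf T}P^\star+\tfrac1{\gamma^2}B_wB_w^{\mathsf T}P^\star$ have negative real part, and such that $Q-\tfrac1{\gamma^2}P^\star B_wB_w^{\mathsf T}P^\star\succ0$. Then, for every $x_0\in\mathbb R^n$, $$\underline p^\star=\overline p^\star=x_0^{\mathsf T}P^\star x_0 ,$$ and the linear static policies $\mu^\star(x(t))=-R^{-1}B^{\mathsf T}P^\star x(t)$, $\nu^\star(x(t))=\tfrac1{\gamma^2}B_w^{\mathsf T}P^\star x(t)$ form a saddle point: $\underline p^\star=\overline p^\star=J_\gamma(\mu^\star,\nu^\star)$ and $$J_\gamma(\mu^\star,\nu)\le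 J_\gamma(\mu^\star,\nu^\star)\le J_\gamma(\mu,\nu^\star)\qquad\text{for all }\mu\in\mathcal M,\ \nu\in\mathcal N .$$ -/

import Mathlib

open Filter Topology Matrix
open scoped NNReal

/-- State histories: continuous trajectories `[0,∞) → ℝⁿ`. -/
abbrev StatePath (n : ℕ) := C(ℝ≥0, Fin n → ℝ)

/-- Piecewise continuity on `[0,∞)`: on every bounded time interval there are only finitely many
discontinuities, and all one-sided limits exist (and are finite). -/
def PiecewiseContinuous {k : ℕ} (f : ℝ≥0 → Fin k → ℝ) : Prop :=
  (∀ T : ℝ≥0, {t : ℝ≥0 | t ≤ T ∧ ¬ ContinuousAt f t}.Finite) ∧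
  (∀ t : ℝ≥0, ∃ l, Tendsto f (𝓝[<] t) (𝓝 l)) ∧
  (∀ t : ℝ≥0, ∃ l, Tendsto f (𝓝[>] t) (𝓝 l))

/-- Closed-loop (state-history-dependent) policies `u(t) = μ(t; x(τ), τ ≤ t)` with values in `ℝᵏ`:
Borel measurable, piecewise continuous in `t`, and Lipschitz continuous in the state history. -/
structure Policy (n k : ℕ) where
  /-- The value `μ(t; x)`. -/
  toFun : ℝ≥0 → StatePath n → Fin k → ℝ
  measurable : @Measurable _ _ (borel (ℝ≥0 × StatePath n)) _
    (fun z : ℝ≥0 × StatePath n => toFun z.1 z.2)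
  piecewiseContinuous : ∀ x : StatePath n, PiecewiseContinuous (fun t => toFun t x)
  /-- `‖μ(t;x) - μ(t;y)‖ ≤ L sup_{τ ≤ t} ‖x(τ) - y(τ)‖`, with `L` uniform on bounded time intervals.
  The case `r = 0` says that `μ(t;x)` depends only on `x(τ)`, `τ ≤ t`. -/
  lipschitz : ∀ T : ℝ≥0, ∃ L : ℝ≥0, ∀ t ≤ T, ∀ (x y : StatePath n) (r : ℝ),
    (∀ τ ≤ t, ‖x τ - y τ‖ ≤ r) → ‖toFun t x - toFun t y‖ ≤ L * r

/-- The linear static state feedback policy `(t; x) ↦ K x(t)`. -/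
def linearPolicy {n k : ℕ} (K : Matrix (Fin k) (Fin n) ℝ) : Policy n k where
  toFun t x := K *ᵥ x t
  measurable := by
    borelize (ℝ≥0 × StatePath n)
    have h : Continuous (fun z : ℝ≥0 × StatePath n => K *ᵥ z.2 z.1) := by fun_prop
    exact h.measurable
  piecewiseContinuous x := by
    have h : Continuous (fun t : ℝ≥0 => K *ᵥ x t) := by fun_prop
    refine ⟨fun T => ?_, fun t => ⟨_, (h.tendsto t).mono_left nhdsWithin_le_nhds⟩,
      fun t => ⟨_, (h.tendsto t).mono_left nhdsWithin_le_nhds⟩⟩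
    convert Set.finite_empty
    ext t
    simp [h.continuousAt]
  lipschitz T := by
    refine ⟨‖LinearMap.toContinuousLinearMap K.mulVecLin‖₊, fun t _ x y r hr => ?_⟩
    have h := (LinearMap.toContinuousLinearMap K.mulVecLin).le_opNorm (x t - y t)
    simp only [LinearMap.coe_toContinuousLinearMap', Matrix.mulVecLin_apply,
      Matrix.mulVec_sub] at h
    exact h.trans (mul_le_mul_of_nonneg_left (hr t le_rfl) (norm_nonneg _))

/-- The data `A, B, B_w, Q, R, γ` of a linear-quadratic game with `n` states, `m` control inputs and
`p` disturbance inputs. -/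
structure LQGame (n m p : ℕ) where
  A : Matrix (Fin n) (Fin n) ℝ
  B : Matrix (Fin n) (Fin m) ℝ
  Bw : Matrix (Fin n) (Fin p) ℝ
  Q : Matrix (Fin n) (Fin n) ℝ
  R : Matrix (Fin m) (Fin m) ℝ
  γ : ℝ

/-- A real square matrix is Hurwitz (stable) if all its complex eigenvalues have negative real
part. -/
def IsHurwitz {n : ℕ} (M : Matrix (Fin n) (Fin n) ℝ) : Prop :=
  ∀ z ∈ spectrum ℂ (M.map (fun a : ℝ => (a : ℂ))), z.re < 0

namespace LQGame

variable {n m p : ℕ}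

/-- `x` solves `ẋ = A x + B u + B_w w`, `x(0) = x₀`, with `u(t) = μ(t; x)` and `w(t) = ν(t; x)`.
The right-hand side is piecewise continuous in time, so the equation is written in integrated form
(the integrand is only used at times `s ≥ 0`). -/
def IsTrajectory (G : LQGame n m p) (x₀ : Fin n → ℝ) (μ : Policy n m) (ν : Policy n p)
    (x : StatePath n) : Prop :=
  ∀ t : ℝ≥0, x t = x₀ + ∫ s in (0 : ℝ)..t,
    (G.A *ᵥ x s.toNNReal + G.B *ᵥ μ.toFun s.toNNReal x + G.Bw *ᵥ ν.toFun s.toNNReal x)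

/-- The running cost `xᵀ Q x + uᵀ R u - γ² ‖w‖²`, with the Euclidean norm `‖w‖² = wᵀ w`. -/
def runningCost (G : LQGame n m p) (x : Fin n → ℝ) (u : Fin m → ℝ) (w : Fin p → ℝ) : ℝ :=
  x ⬝ᵥ G.Q *ᵥ x + u ⬝ᵥ G.R *ᵥ u - G.γ ^ 2 * (w ⬝ᵥ w)

/-- The cost accumulated over `[0, T]` along the state path `x`. -/
noncomputable def costUpTo (G : LQGame n m p) (μ : Policy n m) (ν : Policy n p) (x : StatePath n)
    (T : ℝ≥0) : ℝ :=
  ∫ s in (0 : ℝ)..T,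
    G.runningCost (x s.toNNReal) (μ.toFun s.toNNReal x) (ν.toFun s.toNNReal x)

/-- `c` is the value in `[-∞,∞]` of the improper integral
`∫₀^∞ (xᵀ Q x + uᵀ R u - γ² ‖w‖²) dt` along the trajectory generated by `(μ, ν)` from `x₀`. -/
def HasCost (G : LQGame n m p) (x₀ : Fin n → ℝ) (μ : Policy n m) (ν : Policy n p)
    (c : EReal) : Prop :=
  ∃ x : StatePath n, G.IsTrajectory x₀ μ ν x ∧
    Tendsto (fun T : ℝ≥0 => ((G.costUpTo μ ν x T : ℝ) : EReal)) atTop (𝓝 c)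

open Classical in
/-- The performance measure `J_γ(μ, ν)`: the improper integral whenever it exists in `[-∞,∞]`.
For pairs of policies for which it does not exist, the value is given by a convention `d`. -/
noncomputable def cost (G : LQGame n m p) (d : Policy n m → Policy n p → EReal)
    (x₀ : Fin n → ℝ) (μ : Policy n m) (ν : Policy n p) : EReal :=
  if h : ∃ c : EReal, G.HasCost x₀ μ ν c then h.choose else d μ ν

/-- The upper value `inf_μ sup_ν J_γ(μ, ν)`. -/
noncomputable def upperValue (G : LQGame n m p) (d : Policy n m → Policy n p → EReal)
    (x₀ : Fin n → ℝ) : EReal :=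
  ⨅ μ : Policy n m, ⨆ ν : Policy n p, G.cost d x₀ μ ν

/-- The lower value `sup_ν inf_μ J_γ(μ, ν)`. -/
noncomputable def lowerValue (G : LQGame n m p) (d : Policy n m → Policy n p → EReal)
    (x₀ : Fin n → ℝ) : EReal :=
  ⨆ ν : Policy n p, ⨅ μ : Policy n m, G.cost d x₀ μ ν

/-- `(μ', ν')` is a saddle point (Nash equilibrium): `J_γ(μ', ν')` equals the lower and the upper
value, and neither player gains from a unilateral deviation. -/
def IsSaddlePoint (G : LQGame n m p) (d : Policy n m → Policy n p → EReal) (x₀ : Fin n → ℝ)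
    (μ' : Policy n m) (ν' : Policy n p) : Prop :=
  (G.lowerValue d x₀ = G.cost d x₀ μ' ν' ∧ G.upperValue d x₀ = G.cost d x₀ μ' ν') ∧
  (∀ ν : Policy n p, G.cost d x₀ μ' ν ≤ G.cost d x₀ μ' ν') ∧
  (∀ μ : Policy n m, G.cost d x₀ μ' ν' ≤ G.cost d x₀ μ ν')

/-- The operator `Aᵀ P + P A + Q - P B R⁻¹ Bᵀ P + γ⁻² P B_w B_wᵀ P` of the indefinite algebraic
Riccati equation. -/
noncomputable def riccati (G : LQGame n m p) (P : Matrix (Fin n) (Fin n) ℝ) :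
    Matrix (Fin n) (Fin n) ℝ :=
  G.Aᵀ * P + P * G.A + G.Q - P * G.B * G.R⁻¹ * G.Bᵀ * P
    + (1 / G.γ ^ 2) • (P * G.Bw * G.Bwᵀ * P)

end LQGame

/-!
Completing squares with the Riccati equation, the cost accumulated along any trajectory up to time
`T` is `x₀ᵀPx₀ - x(T)ᵀPx(T)` plus the integral of `(u - u⋆)ᵀR(u - u⋆) - γ²‖w - w⋆‖²`
(`LQGame.IsTrajectory.costUpTo_eq`). So both saddle inequalities follow once the improper integral
is known to exist and, in the cases that matter, `x(T) → 0`. Since no value may be assumed for a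
divergent integral, existence of the limit in `[-∞, ∞]` has to be shown for all pairs in which one
player uses the saddle-point policy.

* If the control plays `u⋆` (`LQGame.exists_hasCost_controlGain_le`), either `∫ ‖w - w⋆‖² = ∞` and
  the cost is `-∞` because `P ⪰ 0`, or the deviation `w - w⋆` is square integrable. In that case
  the storage `xᵀPx` is a Lyapunov function: by `Q - γ⁻²PB_wB_wᵀP ≻ 0` and Young's inequality it
  decays at rate `½ xᵀ(Q - γ⁻²PB_wB_wᵀP)x` up to a multiple of `‖w - w⋆‖²`, so the state is square
  integrable too.
* If the disturbance plays `w⋆` (`LQGame.exists_hasCost_disturbanceGain_ge`), the running cost is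
  `xᵀ(Q - γ⁻²PB_wB_wᵀP)x + uᵀRu`, a positive definite form in `(x, u)`. Its integral is either
  `+∞`, or state and control are square integrable.

In both square integrable cases `xᵀPx` and its derivative are integrable, so `xᵀPx → 0`
(`tendsto_zero_of_dominated`). This Lyapunov argument takes the place of exponential estimates for
the closed-loop matrices. The values of the game then follow from the two inequalities and from
`sup inf ≤ inf sup`, whatever convention is used for the other pairs of policies.

Trajectories exist and are unique because the Picard operator of a causal Lipschitz field halves
distances on `[0, T]` in a norm with exponential weight (`picard_contracts`).
-/

/-! ### Regular signals and piecewise continuity -/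

/-- A signal that can be integrated and differentiated along trajectories: measurable, bounded on
every half-line `(-∞, T]`, and continuous at all but countably many positive times.
Signals on `[0, ∞)` are viewed on `ℝ` by freezing them at their initial value for `s < 0`, which
is why boundedness may be asked on all of `(-∞, T]`. -/
structure RegularSignal {E : Type*} [NormedAddCommGroup E] [MeasurableSpace E] (z : ℝ → E) :
    Prop where
  measurable : Measurable z
  bounded : ∀ T, ∃ C, ∀ s ≤ T, ‖z s‖ ≤ C
  countable : {s | 0 < s ∧ ¬ ContinuousAt z s}.Countable

namespace RegularSignal

open MeasureTheory

variable {E F : Type*} [NormedAddCommGroup E] [MeasurableSpace E]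
  [NormedAddCommGroup F] [MeasurableSpace F]

lemma prodMk {z : ℝ → E} {y : ℝ → F} (hz : RegularSignal z) (hy : RegularSignal y) :
    RegularSignal fun s => (z s, y s) where
  measurable := hz.measurable.prodMk hy.measurable
  bounded T := by
    obtain ⟨C, hC⟩ := hz.bounded T
    obtain ⟨D, hD⟩ := hy.bounded T
    exact ⟨max C D, fun s hs => max_le_max (hC s hs) (hD s hs)⟩
  countable := by
    refine (hz.countable.union hy.countable).mono ?_
    rintro s ⟨hs, h⟩
    by_contra! hcon
    simp only [Set.mem_union, Set.mem_ofPred_eq, not_or, not_and, not_not] at hcon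
    exact h ((hcon.1 hs).prodMk (hcon.2 hs))

lemma comp [BorelSpace E] [BorelSpace F] [ProperSpace E] {z : ℝ → E} (hz : RegularSignal z)
    {g : E → F} (hg : Continuous g) : RegularSignal fun s => g (z s) where
  measurable := hg.measurable.comp hz.measurable
  bounded T := by
    obtain ⟨C, hC⟩ := hz.bounded T
    obtain ⟨D, hD⟩ := (isCompact_closedBall (0 : E) C).exists_bound_of_continuousOn hg.continuousOn
    exact ⟨D, fun s hs => hD _ (by simpa using hC s hs)⟩
  countable := by
    refine hz.countable.mono ?_
    rintro s ⟨hs, h⟩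
    exact ⟨hs, fun hc => h (hg.continuousAt.comp hc)⟩

lemma intervalIntegrable [BorelSpace E] [SecondCountableTopology E] {z : ℝ → E}
    (hz : RegularSignal z) (a b : ℝ) : IntervalIntegrable z volume a b := by
  obtain ⟨C, hC⟩ := hz.bounded (max a b)
  rw [intervalIntegrable_iff]
  refine Measure.integrableOn_of_bounded (M := C) (by simp)
    hz.measurable.aestronglyMeasurable ?_
  filter_upwards [ae_restrict_mem measurableSet_uIoc] with s hs
  exact hC s hs.2

lemma hasDerivAt_integral [BorelSpace E] [SecondCountableTopology E] [NormedSpace ℝ E]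
    [CompleteSpace E] {z : ℝ → E} (hz : RegularSignal z) {t : ℝ} (ht : ContinuousAt z t) :
    HasDerivAt (fun u => ∫ s in (0 : ℝ)..u, z s) (z t) t :=
  intervalIntegral.integral_hasDerivAt_right (hz.intervalIntegrable 0 t)
    hz.measurable.stronglyMeasurable.stronglyMeasurableAtFilter ht

end RegularSignal

/-- A piecewise continuous function is bounded on bounded time intervals: near every time it is
bounded because of its one-sided limits, and compactness does the rest. -/
lemma PiecewiseContinuous.bounded {k : ℕ} {f : ℝ≥0 → Fin k → ℝ} (hf : PiecewiseContinuous f)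
    (T : ℝ≥0) : ∃ C, ∀ t ≤ T, ‖f t‖ ≤ C := by
  have key : ∃ C, ∀ t ∈ Set.Icc 0 T, ‖f t‖ ≤ C := by
    refine (isCompact_Icc (a := 0) (b := T)).induction_on
      (p := fun S => ∃ C, ∀ t ∈ S, ‖f t‖ ≤ C) ⟨0, by simp⟩ ?_ ?_ ?_
    · rintro s t hst ⟨C, hC⟩
      exact ⟨C, fun u hu => hC u (hst hu)⟩
    · rintro s t ⟨C, hC⟩ ⟨D, hD⟩
      refine ⟨max C D, fun u hu => ?_⟩
      rcases hu with hu | hu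
      · exact (hC u hu).trans (le_max_left _ _)
      · exact (hD u hu).trans (le_max_right _ _)
    · intro t _
      obtain ⟨l, hl⟩ := hf.2.1 t
      obtain ⟨r, hr⟩ := hf.2.2 t
      have h1 : ∀ᶠ s in 𝓝[<] t, ‖f s‖ ≤ max (max (‖l‖ + 1) (‖r‖ + 1)) ‖f t‖ := by
        filter_upwards [hl.norm.eventually (gt_mem_nhds (lt_add_one ‖l‖))] with s hs
        exact hs.le.trans ((le_max_left _ _).trans (le_max_left _ _))
      have h2 : ∀ᶠ s in 𝓝[>] t, ‖f s‖ ≤ max (max (‖l‖ + 1) (‖r‖ + 1)) ‖f t‖ := by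
        filter_upwards [hr.norm.eventually (gt_mem_nhds (lt_add_one ‖r‖))] with s hs
        exact hs.le.trans ((le_max_right _ _).trans (le_max_left _ _))
      have h3 : ∀ᶠ s in 𝓝[≠] t, ‖f s‖ ≤ max (max (‖l‖ + 1) (‖r‖ + 1)) ‖f t‖ := by
        rw [← nhdsLT_sup_nhdsGT]
        exact eventually_sup.2 ⟨h1, h2⟩
      have h4 : ∀ᶠ s in 𝓝 t, ‖f s‖ ≤ max (max (‖l‖ + 1) (‖r‖ + 1)) ‖f t‖ := by
        rw [← nhdsNE_sup_pure]
        exact eventually_sup.2 ⟨h3, eventually_pure.2 (le_max_right _ _)⟩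
      exact ⟨_, mem_nhdsWithin_of_mem_nhds h4, _, fun s hs => hs⟩
  obtain ⟨C, hC⟩ := key
  exact ⟨C, fun t ht => hC t ⟨zero_le, ht⟩⟩

lemma PiecewiseContinuous.countable {k : ℕ} {f : ℝ≥0 → Fin k → ℝ} (hf : PiecewiseContinuous f) :
    {t | ¬ ContinuousAt f t}.Countable := by
  refine (Set.countable_iUnion fun N : ℕ => (hf.1 N).countable).mono ?_
  intro t ht
  obtain ⟨N, hN⟩ := exists_nat_ge t
  exact Set.mem_iUnion.2 ⟨N, hN, ht⟩

/-- The signal `s ↦ μ(s; x)` produced by a policy along a fixed state path is regular. -/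
lemma Policy.regularSignal {n k : ℕ} (μ : Policy n k) (x : StatePath n) :
    RegularSignal fun s : ℝ => μ.toFun s.toNNReal x where
  measurable := by
    borelize (ℝ≥0 × StatePath n)
    have h : Continuous fun s : ℝ => (s.toNNReal, x) := by fun_prop
    exact μ.measurable.comp h.measurable
  bounded T := by
    obtain ⟨C, hC⟩ := (μ.piecewiseContinuous x).bounded T.toNNReal
    exact ⟨C, fun s hs => hC _ (Real.toNNReal_le_toNNReal hs)⟩
  countable := by
    refine ((μ.piecewiseContinuous x).countable.image ((↑) : ℝ≥0 → ℝ)).mono ?_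
    rintro s ⟨hs, h⟩
    refine ⟨s.toNNReal, fun hc => h ?_, Real.coe_toNNReal s hs.le⟩
    exact ContinuousAt.comp (f := Real.toNNReal) (g := fun t => μ.toFun t x) hc
      continuous_real_toNNReal.continuousAt

lemma StatePath.regularSignal {n : ℕ} (x : StatePath n) :
    RegularSignal fun s : ℝ => x s.toNNReal where
  measurable := by
    have h : Continuous fun s : ℝ => x s.toNNReal := by fun_prop
    exact h.measurable
  bounded T := by
    obtain ⟨C, hC⟩ := (isCompact_Icc (a := 0) (b := T.toNNReal)).exists_bound_of_continuousOn
      x.continuous.continuousOn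
    exact ⟨C, fun s hs => hC _ ⟨zero_le, Real.toNNReal_le_toNNReal hs⟩⟩
  countable := by
    refine Set.countable_empty.mono ?_
    rintro s ⟨-, h⟩
    exact h (by fun_prop)

/-! ### Causal integral equations -/

section CausalODE

variable {n : ℕ} {F : ℝ≥0 → StatePath n → Fin n → ℝ}

/-- The Picard operator `x ↦ x₀ + ∫₀ᵗ F(s; x) ds` on state paths. -/
noncomputable def picard (hreg : ∀ x, RegularSignal fun s : ℝ => F s.toNNReal x) (x₀ : Fin n → ℝ)
    (x : StatePath n) : StatePath n where
  toFun t := x₀ + ∫ s in (0 : ℝ)..t, F s.toNNReal x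
  continuous_toFun := continuous_const.add
    ((intervalIntegral.continuous_primitive (fun a b => (hreg x).intervalIntegrable a b) 0).comp
      NNReal.continuous_coe)

/-- In the weighted norm with weight `exp (2 L t)`, the Picard operator of a causal field with
Lipschitz constant `L` on `[0, T]` halves distances. -/
lemma picard_contracts (hreg : ∀ x, RegularSignal fun s : ℝ => F s.toNNReal x)
    (x₀ : Fin n → ℝ) {T L : ℝ≥0} (hL : 0 < L)
    (hlip : ∀ t ≤ T, ∀ (x y : StatePath n) (r : ℝ),
      (∀ τ ≤ t, ‖x τ - y τ‖ ≤ r) → ‖F t x - F t y‖ ≤ L * r)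
    {x y : StatePath n} {c : ℝ} (hc : 0 ≤ c)
    (hxy : ∀ t ≤ T, ‖x t - y t‖ ≤ c * Real.exp (2 * L * t)) :
    ∀ t ≤ T, ‖picard hreg x₀ x t - picard hreg x₀ y t‖ ≤ c / 2 * Real.exp (2 * L * t) := by
  intro t ht
  have hL' : (0 : ℝ) < L := hL
  have hd : ∀ s : ℝ, HasDerivAt (fun u : ℝ => c / 2 * Real.exp (2 * L * u))
      (L * (c * Real.exp (2 * L * s))) s := by
    intro s
    have := (((hasDerivAt_id s).const_mul (2 * (L : ℝ))).exp).const_mul (c / 2)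
    convert! this using 1
    simp; ring
  have hcont : Continuous fun s : ℝ => L * (c * Real.exp (2 * L * s)) := by fun_prop
  have hint := intervalIntegral.integral_eq_sub_of_hasDerivAt (a := 0) (b := t)
    (fun s _ => hd s) (hcont.intervalIntegrable _ _)
  have hbound : ‖∫ s in (0 : ℝ)..t, (F s.toNNReal x - F s.toNNReal y)‖
      ≤ ∫ s in (0 : ℝ)..t, L * (c * Real.exp (2 * L * s)) := by
    refine intervalIntegral.norm_integral_le_of_norm_le t.2 ?_ (hcont.intervalIntegrable _ _)
    refine Eventually.of_forall fun s hs => ?_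
    have hs' : s.toNNReal ≤ t := Real.toNNReal_le_iff_le_coe.2 hs.2
    have hsc : (s.toNNReal : ℝ) = s := Real.coe_toNNReal s hs.1.le
    refine hlip _ (hs'.trans ht) x y _ fun τ hτ => ?_
    refine (hxy τ (hτ.trans (hs'.trans ht))).trans ?_
    have : (τ : ℝ) ≤ s := by rw [← hsc]; exact_mod_cast hτ
    gcongr
  have hsub : picard hreg x₀ x t - picard hreg x₀ y t
      = ∫ s in (0 : ℝ)..t, (F s.toNNReal x - F s.toNNReal y) := by
    rw [intervalIntegral.integral_sub ((hreg x).intervalIntegrable _ _)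
      ((hreg y).intervalIntegrable _ _)]
    simp [picard]
  rw [hsub]
  refine hbound.trans ?_
  rw [hint]
  simp only [mul_zero, Real.exp_zero, mul_one]
  linarith

/-- Global existence and uniqueness for the integral equation `x(t) = x₀ + ∫₀ᵗ F(s; x) ds` with a
causal vector field that is Lipschitz in the history, uniformly on bounded time intervals. -/
theorem existsUnique_causal_integral_equation
    (hreg : ∀ x, RegularSignal fun s : ℝ => F s.toNNReal x)
    (hlip : ∀ T : ℝ≥0, ∃ L : ℝ≥0, ∀ t ≤ T, ∀ (x y : StatePath n) (r : ℝ),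
      (∀ τ ≤ t, ‖x τ - y τ‖ ≤ r) → ‖F t x - F t y‖ ≤ L * r) (x₀ : Fin n → ℝ) :
    ∃! x : StatePath n, ∀ t : ℝ≥0, x t = x₀ + ∫ s in (0 : ℝ)..t, F s.toNNReal x := by
  have hlip' : ∀ T : ℝ≥0, ∃ L : ℝ≥0, 0 < L ∧ ∀ t ≤ T, ∀ (x y : StatePath n) (r : ℝ),
      (∀ τ ≤ t, ‖x τ - y τ‖ ≤ r) → ‖F t x - F t y‖ ≤ L * r := by
    intro T
    obtain ⟨L, hL⟩ := hlip T
    refine ⟨L + 1, by positivity, fun t ht x y r h => (hL t ht x y r h).trans ?_⟩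
    have hr : 0 ≤ r := (norm_nonneg _).trans (h t le_rfl)
    push_cast
    nlinarith
  choose L hLpos hL using hlip'
  set Φ := picard hreg x₀ with hΦ
  -- any two paths are at finite weighted distance on `[0, T]`
  have hdist : ∀ (T : ℝ≥0) (x y : StatePath n),
      ∃ c : ℝ, 0 ≤ c ∧ ∀ t ≤ T, ‖x t - y t‖ ≤ c * Real.exp (2 * L T * t) := by
    intro T x y
    obtain ⟨C, hC⟩ := (isCompact_Icc (a := 0) (b := T)).exists_bound_of_continuousOn
      (x - y).continuous.continuousOn
    have hC0 : 0 ≤ C := (norm_nonneg _).trans (hC 0 ⟨le_rfl, zero_le⟩)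
    refine ⟨C, hC0, fun t ht => (hC t ⟨zero_le, ht⟩).trans ?_⟩
    exact le_mul_of_one_le_right hC0 (Real.one_le_exp (by positivity))
  have hiter : ∀ (T : ℝ≥0) (x y : StatePath n), ∃ c : ℝ, 0 ≤ c ∧ ∀ k : ℕ, ∀ t ≤ T,
      ‖Φ^[k] x t - Φ^[k] y t‖ ≤ c * (1 / 2) ^ k := by
    intro T x y
    obtain ⟨c, hc, h⟩ := hdist T x y
    have h' : ∀ k : ℕ, ∀ t ≤ T,
        ‖Φ^[k] x t - Φ^[k] y t‖ ≤ c * (1 / 2) ^ k * Real.exp (2 * L T * t) := by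
      intro k
      induction k with
      | zero => simpa using h
      | succ k ih =>
        rw [Function.iterate_succ_apply', Function.iterate_succ_apply']
        intro t ht
        have := picard_contracts hreg x₀ (hLpos T) (hL T) (by positivity) ih t ht
        rw [pow_succ]
        convert this using 2
        ring
    refine ⟨c * Real.exp (2 * L T * T), by positivity, fun k t ht => (h' k t ht).trans ?_⟩
    have : Real.exp (2 * L T * t) ≤ Real.exp (2 * L T * T) := by
      have : (t : ℝ) ≤ T := ht
      gcongr
    calc c * (1 / 2) ^ k * Real.exp (2 * L T * t)
        ≤ c * (1 / 2) ^ k * Real.exp (2 * L T * T) := by gcongr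
      _ = _ := by ring
  have hfix : ∀ x : StatePath n,
      (∀ t : ℝ≥0, x t = x₀ + ∫ s in (0 : ℝ)..t, F s.toNNReal x) ↔ Φ x = x := by
    intro x
    constructor
    · intro h; ext1 t; exact (h t).symm
    · intro h t; exact (DFunLike.congr_fun h t).symm
  simp only [hfix]
  -- the Picard iterates converge, uniformly on bounded time intervals
  let X : ℕ → StatePath n := fun k => Φ^[k] (ContinuousMap.const _ x₀)
  have hX : ∀ T : ℝ≥0, ∃ c : ℝ, 0 ≤ c ∧ ∀ t ≤ T, ∀ k,
      dist (X k t) (X (k + 1) t) ≤ c * (1 / 2) ^ k := by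
    intro T
    obtain ⟨c, hc, h⟩ := hiter T (ContinuousMap.const _ x₀) (Φ (ContinuousMap.const _ x₀))
    refine ⟨c, hc, fun t ht k => ?_⟩
    rw [dist_eq_norm]
    exact h k t ht
  have hlim : ∀ t : ℝ≥0, ∃ y, Tendsto (fun k => X k t) atTop (𝓝 y) := by
    intro t
    obtain ⟨c, -, h⟩ := hX t
    exact cauchySeq_tendsto_of_complete
      (cauchySeq_of_le_geometric (1 / 2) c (by norm_num) (h t le_rfl))
  choose y hy using hlim
  have hyX : ∀ T : ℝ≥0, ∃ c : ℝ, 0 ≤ c ∧ ∀ t ≤ T, ∀ k, dist (X k t) (y t) ≤ c * (1 / 2) ^ k := by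
    intro T
    obtain ⟨c, hc, h⟩ := hX T
    refine ⟨c / (1 - 1 / 2), by positivity, fun t ht k => ?_⟩
    have := dist_le_of_le_geometric_of_tendsto (1 / 2) c (by norm_num) (h t ht) (hy t) k
    convert this using 1
    ring
  have hgeo : ∀ c : ℝ, Tendsto (fun k : ℕ => c * (1 / 2 : ℝ) ^ k) atTop (𝓝 0) := by
    intro c
    simpa using (tendsto_pow_atTop_nhds_zero_of_lt_one (r := (1 / 2 : ℝ)) (by norm_num)
      (by norm_num)).const_mul c
  have hycont : Continuous y := by
    refine TendstoLocallyUniformly.continuous (F := fun k t => X k t) (p := atTop) ?_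
      (Frequently.of_forall fun k => (X k).continuous)
    rw [Metric.tendstoLocallyUniformly_iff]
    intro ε hε t
    obtain ⟨c, hc, h⟩ := hyX (t + 1)
    refine ⟨Set.Iic (t + 1), Iic_mem_nhds (by simp), ?_⟩
    filter_upwards [(hgeo c).eventually (gt_mem_nhds hε)] with k hk s hs
    rw [dist_comm]
    exact (h s hs k).trans_lt hk
  let Y : StatePath n := ⟨y, hycont⟩
  refine ⟨Y, ?_, ?_⟩
  · ext1 t
    -- both sides are limits of the shifted iterates
    have h1 : Tendsto (fun k => X (k + 1) t) atTop (𝓝 (Y t)) :=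
      (hy t).comp (tendsto_add_atTop_nat 1)
    have h2 : Tendsto (fun k => X (k + 1) t) atTop (𝓝 (Φ Y t)) := by
      obtain ⟨c, hc, h⟩ := hyX t
      rw [tendsto_iff_norm_sub_tendsto_zero]
      refine squeeze_zero (fun _ => norm_nonneg _) (fun k => ?_)
        (hgeo (c / 2 * Real.exp (2 * L t * t)))
      have hc' := picard_contracts hreg x₀ (hLpos t) (hL t) (x := X k) (y := Y)
        (c := c * (1 / 2) ^ k) (by positivity) (fun s hs => by
          have := h s hs k
          rw [dist_eq_norm] at this
          exact this.trans (le_mul_of_one_le_right (by positivity)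
            (Real.one_le_exp (by positivity)))) t le_rfl
      have hXs : X (k + 1) = Φ (X k) := Function.iterate_succ_apply' _ _ _
      rw [hXs]
      refine hc'.trans (le_of_eq ?_)
      ring
    exact tendsto_nhds_unique h2 h1
  · intro z hz
    have hYfix : ∀ (w : StatePath n), Φ w = w → ∀ k, Φ^[k] w = w := fun w hw k =>
      Function.iterate_fixed hw k
    ext1 t
    obtain ⟨c, hc, h⟩ := hiter t z (ContinuousMap.const _ x₀)
    have h1 : Tendsto (fun k => X k t) atTop (𝓝 (z t)) := by
      rw [tendsto_iff_norm_sub_tendsto_zero]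
      refine squeeze_zero (fun _ => norm_nonneg _) (fun k => ?_) (hgeo c)
      have := h k t le_rfl
      rwa [hYfix z hz k, norm_sub_rev] at this
    exact tendsto_nhds_unique h1 (hy t)

end CausalODE

/-! ### Homogeneous functions, decay at infinity and quadratic forms -/

/-- On a finite-dimensional space, a positive definite quadratically homogeneous function
dominates every other one: compare them on the unit sphere. -/
lemma exists_abs_le_mul_of_homogeneous {E : Type*} [NormedAddCommGroup E] [NormedSpace ℝ E]
    [FiniteDimensional ℝ E] {g h : E → ℝ} (hg : Continuous g) (hh : Continuous h)
    (hg2 : ∀ (c : ℝ) z, g (c • z) = c ^ 2 * g z) (hh2 : ∀ (c : ℝ) z, h (c • z) = c ^ 2 * h z)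
    (hpos : ∀ z, z ≠ 0 → 0 < g z) : ∃ C, 0 ≤ C ∧ ∀ z, |h z| ≤ C * g z := by
  have : ProperSpace E := FiniteDimensional.proper ℝ E
  have hne : ∀ z ∈ Metric.sphere (0 : E) 1, z ≠ 0 := by
    rintro z hz rfl
    simp at hz
  obtain ⟨C, hC⟩ := (isCompact_sphere (0 : E) 1).exists_bound_of_continuousOn
    (f := fun z => h z / g z)
    (hh.continuousOn.div hg.continuousOn fun z hz => (hpos z (hne z hz)).ne')
  refine ⟨max C 0, le_max_right _ _, fun z => ?_⟩
  rcases eq_or_ne z 0 with rfl | hz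
  · have h0 := hh2 0 0
    have g0 := hg2 0 0
    simp only [zero_smul, ne_eq, OfNat.ofNat_ne_zero, not_false_eq_true, zero_pow, zero_mul]
      at h0 g0
    simp [h0, g0]
  · have hs : (‖z‖⁻¹ • z) ∈ Metric.sphere (0 : E) 1 := by
      simp [norm_smul, hz]
    have hb := hC _ hs
    have hgp := hpos _ (hne _ hs)
    rw [norm_div, Real.norm_eq_abs, Real.norm_eq_abs, abs_of_pos hgp, div_le_iff₀ hgp, hh2, hg2,
      abs_mul, abs_of_nonneg (sq_nonneg ‖z‖⁻¹), mul_left_comm] at hb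
    have hz' : 0 < ‖z‖⁻¹ ^ 2 := by positivity
    exact (le_of_mul_le_mul_left hb hz').trans
      (mul_le_mul_of_nonneg_right (le_max_left _ _) (hpos z hz).le)

open MeasureTheory in
/-- If `V` and its derivative `D` are both dominated by a signal `g` with bounded integrals, then
`V` tends to zero: it converges because `D` is integrable, and the limit vanishes because `V`
itself is integrable. -/
lemma tendsto_zero_of_dominated {V D g : ℝ → ℝ} (hV : RegularSignal V) (hD : RegularSignal D)
    (hg : RegularSignal g) (hVD : ∀ T, 0 ≤ T → V T = V 0 + ∫ s in (0 : ℝ)..T, D s)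
    {C C' M : ℝ} (hVg : ∀ s, |V s| ≤ C * g s) (hDg : ∀ s, |D s| ≤ C' * g s) (hg0 : ∀ s, 0 ≤ g s)
    (hM : ∀ T : ℝ≥0, ∫ s in (0 : ℝ)..T, g s ≤ M) : Tendsto V atTop (𝓝 0) := by
  have hgint : IntegrableOn g (Set.Ioi 0) := by
    refine integrableOn_Ioi_of_intervalIntegral_norm_bounded (b := ((↑) : ℝ≥0 → ℝ)) (l := atTop)
      M 0 (fun T => ?_) (NNReal.tendsto_coe_atTop.2 tendsto_id) (Eventually.of_forall fun T => ?_)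
    · exact (intervalIntegrable_iff_integrableOn_Ioc_of_le T.2).1 (hg.intervalIntegrable 0 T)
    · simpa only [Real.norm_eq_abs, abs_of_nonneg (hg0 _)] using hM T
  have hVint : IntegrableOn V (Set.Ioi 0) :=
    (hgint.const_mul C).mono' hV.measurable.aestronglyMeasurable (Eventually.of_forall hVg)
  have hDint : IntegrableOn D (Set.Ioi 0) :=
    (hgint.const_mul C').mono' hD.measurable.aestronglyMeasurable (Eventually.of_forall hDg)
  have hlim : Tendsto V atTop (𝓝 (V 0 + ∫ s in Set.Ioi 0, D s)) := by
    refine Tendsto.congr' ?_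
      ((intervalIntegral_tendsto_integral_Ioi 0 hDint tendsto_id).const_add (V 0))
    filter_upwards [eventually_ge_atTop 0] with T hT
    exact (hVD T hT).symm
  have h0 : V 0 + ∫ s in Set.Ioi 0, D s = 0 := by
    refine IntegrableAtFilter.eq_zero_of_tendsto ⟨Set.Ioi 0, Ioi_mem_atTop _, hVint⟩ ?_ hlim
    intro s hs
    obtain ⟨b, hb⟩ := mem_atTop_sets.1 hs
    rw [← top_le_iff, ← Real.volume_Ici (a := b)]
    exact measure_mono hb
  rwa [h0] at hlim

lemma RegularSignal.integral_tendsto_atTop_or_bounded {g : ℝ → ℝ} (hg : RegularSignal g)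
    (hg0 : ∀ s, 0 ≤ g s) :
    Tendsto (fun T : ℝ≥0 => ∫ s in (0 : ℝ)..T, g s) atTop atTop ∨
      ∃ l, Tendsto (fun T : ℝ≥0 => ∫ s in (0 : ℝ)..T, g s) atTop (𝓝 l) ∧
        ∀ T : ℝ≥0, ∫ s in (0 : ℝ)..T, g s ≤ l := by
  have hmono : Monotone fun T : ℝ≥0 => ∫ s in (0 : ℝ)..T, g s := by
    intro S T hST
    exact intervalIntegral.integral_mono_interval le_rfl S.2 hST
      (Eventually.of_forall hg0) (hg.intervalIntegrable _ _)
  rcases tendsto_atTop_of_monotone hmono with h | ⟨l, h⟩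
  · exact .inl h
  · exact .inr ⟨l, h, hmono.ge_of_tendsto h⟩

lemma HasDerivAt.dotProduct_mulVec {n : ℕ} (P : Matrix (Fin n) (Fin n) ℝ) {X : ℝ → Fin n → ℝ}
    {X' : Fin n → ℝ} {t : ℝ} (hX : HasDerivAt X X' t) :
    HasDerivAt (fun s => X s ⬝ᵥ P *ᵥ X s) (X' ⬝ᵥ P *ᵥ X t + X t ⬝ᵥ P *ᵥ X') t := by
  have hPX : HasDerivAt (fun s => P *ᵥ X s) (P *ᵥ X') t :=
    (LinearMap.toContinuousLinearMap P.mulVecLin).hasFDerivAt.comp_hasDerivAt t hX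
  have h := HasDerivAt.fun_sum (u := Finset.univ) fun i _ =>
    (hasDerivAt_pi.1 hX i).mul (hasDerivAt_pi.1 hPX i)
  rw [Finset.sum_add_distrib] at h
  exact h

lemma dotProduct_mulVec_eq {m n : ℕ} (M : Matrix (Fin m) (Fin n) ℝ) (x : Fin m → ℝ)
    (y : Fin n → ℝ) : x ⬝ᵥ M *ᵥ y = Mᵀ *ᵥ x ⬝ᵥ y := by
  rw [Matrix.dotProduct_mulVec, Matrix.mulVec_transpose]

lemma dotProduct_self_nonneg_real {n : ℕ} (x : Fin n → ℝ) : 0 ≤ x ⬝ᵥ x := by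
  simpa using dotProduct_star_self_nonneg x

/-! ### Completion of squares and dissipation -/

namespace LQGame

variable {n m p : ℕ} (G : LQGame n m p)

/-- The right-hand side `A x + B u + B_w w` of the state equation. -/
def drift (x : Fin n → ℝ) (u : Fin m → ℝ) (w : Fin p → ℝ) : Fin n → ℝ :=
  G.A *ᵥ x + G.B *ᵥ u + G.Bw *ᵥ w

/-- The derivative of the storage function `xᵀ P x` along the state equation. -/
def storageRate (P : Matrix (Fin n) (Fin n) ℝ) (x : Fin n → ℝ) (u : Fin m → ℝ)
    (w : Fin p → ℝ) : ℝ :=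
  G.drift x u w ⬝ᵥ P *ᵥ x + x ⬝ᵥ P *ᵥ G.drift x u w

/-- The gain `-R⁻¹ Bᵀ P` of the saddle-point control. -/
noncomputable def controlGain (P : Matrix (Fin n) (Fin n) ℝ) : Matrix (Fin m) (Fin n) ℝ :=
  -(G.R⁻¹ * G.Bᵀ * P)

/-- The gain `γ⁻² B_wᵀ P` of the saddle-point disturbance. -/
noncomputable def disturbanceGain (P : Matrix (Fin n) (Fin n) ℝ) : Matrix (Fin p) (Fin n) ℝ :=
  (1 / G.γ ^ 2) • (G.Bwᵀ * P)

/-- The state weight `Q - γ⁻² P B_w B_wᵀ P` that the running cost has once the disturbance plays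
its saddle-point policy. -/
noncomputable def reducedWeight (P : Matrix (Fin n) (Fin n) ℝ) : Matrix (Fin n) (Fin n) ℝ :=
  G.Q - (1 / G.γ ^ 2) • (P * G.Bw * G.Bwᵀ * P)

@[fun_prop]
lemma continuous_runningCost {E : Type*} [TopologicalSpace E] {x : E → Fin n → ℝ}
    {u : E → Fin m → ℝ} {w : E → Fin p → ℝ} (hx : Continuous x) (hu : Continuous u)
    (hw : Continuous w) : Continuous fun e => G.runningCost (x e) (u e) (w e) := by
  unfold runningCost
  fun_prop

@[fun_prop]
lemma continuous_storageRate (P : Matrix (Fin n) (Fin n) ℝ) {E : Type*} [TopologicalSpace E]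
    {x : E → Fin n → ℝ} {u : E → Fin m → ℝ} {w : E → Fin p → ℝ} (hx : Continuous x)
    (hu : Continuous u) (hw : Continuous w) :
    Continuous fun e => G.storageRate P (x e) (u e) (w e) := by
  unfold storageRate drift
  fun_prop

lemma storageRate_smul (P : Matrix (Fin n) (Fin n) ℝ) (c : ℝ) (x : Fin n → ℝ) (u : Fin m → ℝ)
    (w : Fin p → ℝ) :
    G.storageRate P (c • x) (c • u) (c • w) = c ^ 2 * G.storageRate P x u w := by
  have : G.drift (c • x) (c • u) (c • w) = c • G.drift x u w := by
    simp [drift, mulVec_smul]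
  simp only [storageRate, this, mulVec_smul, smul_dotProduct, dotProduct_smul, smul_eq_mul]
  ring

section Algebra

variable {G} {P : Matrix (Fin n) (Fin n) ℝ}

/-- Completion of squares: by the Riccati equation, storage rate plus running cost is a difference
of squares of the deviations from the saddle-point policies. -/
lemma storageRate_add_runningCost (hγ : 0 < G.γ) (hR : G.R.PosDef) (hP : Pᵀ = P)
    (hARE : G.riccati P = 0) (x : Fin n → ℝ) (u : Fin m → ℝ) (w : Fin p → ℝ) :
    G.storageRate P x u w + G.runningCost x u w =
      (u - G.controlGain P *ᵥ x) ⬝ᵥ G.R *ᵥ (u - G.controlGain P *ᵥ x)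
        - G.γ ^ 2 * ((w - G.disturbanceGain P *ᵥ x) ⬝ᵥ (w - G.disturbanceGain P *ᵥ x)) := by
  have hRT : G.Rᵀ = G.R := by simpa using hR.isHermitian.eq
  have hRdet : IsUnit G.R.det := (Matrix.isUnit_iff_isUnit_det _).1 hR.isUnit
  set q := P *ᵥ x with hq
  set b := G.Bᵀ *ᵥ q with hb
  set c := G.Bwᵀ *ᵥ q with hc
  set r := G.R⁻¹ *ᵥ b with hr
  have hK : G.controlGain P *ᵥ x = -r := by
    simp [controlGain, hr, hb, hq, neg_mulVec, mulVec_mulVec, Matrix.mul_assoc]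
  have hL : G.disturbanceGain P *ᵥ x = (1 / G.γ ^ 2) • c := by
    simp [disturbanceGain, hc, hq, smul_mulVec, mulVec_mulVec]
  have hRr : G.R *ᵥ r = b := by
    rw [hr, mulVec_mulVec, Matrix.mul_nonsing_inv _ hRdet, one_mulVec]
  have hxP : ∀ y, x ⬝ᵥ P *ᵥ y = q ⬝ᵥ y := fun y => by rw [dotProduct_mulVec_eq, hP]
  have hqB : ∀ y, q ⬝ᵥ G.B *ᵥ y = b ⬝ᵥ y := fun y => dotProduct_mulVec_eq _ _ _
  have hqBw : ∀ y, q ⬝ᵥ G.Bw *ᵥ y = c ⬝ᵥ y := fun y => dotProduct_mulVec_eq _ _ _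
  have hxA : x ⬝ᵥ G.Aᵀ *ᵥ q = q ⬝ᵥ G.A *ᵥ x := by
    rw [dotProduct_mulVec_eq, transpose_transpose, dotProduct_comm]
  have hare : q ⬝ᵥ G.A *ᵥ x + q ⬝ᵥ G.A *ᵥ x + x ⬝ᵥ G.Q *ᵥ x - b ⬝ᵥ r
      + 1 / G.γ ^ 2 * (c ⬝ᵥ c) = 0 := by
    have h : x ⬝ᵥ G.riccati P *ᵥ x = 0 := by simp [hARE]
    simpa only [riccati, add_mulVec, sub_mulVec, smul_mulVec, ← mulVec_mulVec, dotProduct_add,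
      dotProduct_sub, dotProduct_smul, smul_eq_mul, ← hq, ← hb, ← hc, ← hr, hxP, hqB, hqBw,
      hxA] using h
  have hrR : r ⬝ᵥ G.R *ᵥ u = b ⬝ᵥ u := by rw [dotProduct_mulVec_eq, hRT, hRr]
  have hγ' : G.γ ^ 2 * (1 / G.γ ^ 2) = 1 := by field_simp
  rw [hK, hL]
  simp only [storageRate, drift, runningCost, ← hq, hxP, sub_neg_eq_add, mulVec_add, hRr,
    dotProduct_add, add_dotProduct, sub_dotProduct, dotProduct_sub, smul_dotProduct,
    dotProduct_smul, smul_eq_mul, hrR, hqB, hqBw, dotProduct_comm (G.A *ᵥ x) q,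
    dotProduct_comm (G.B *ᵥ u) q, dotProduct_comm (G.Bw *ᵥ w) q, dotProduct_comm u b,
    dotProduct_comm r b, dotProduct_comm w c]
  linear_combination hare + (1 / G.γ ^ 2 * (c ⬝ᵥ c) - 2 * (c ⬝ᵥ w)) * hγ'

lemma runningCost_disturbanceGain (hγ : 0 < G.γ) (hP : Pᵀ = P) (x : Fin n → ℝ)
    (u : Fin m → ℝ) :
    G.runningCost x u (G.disturbanceGain P *ᵥ x)
      = x ⬝ᵥ G.reducedWeight P *ᵥ x + u ⬝ᵥ G.R *ᵥ u := by
  set c := G.Bwᵀ *ᵥ P *ᵥ x with hc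
  have hL : G.disturbanceGain P *ᵥ x = (1 / G.γ ^ 2) • c := by
    simp [disturbanceGain, hc, smul_mulVec, mulVec_mulVec]
  have hS : x ⬝ᵥ G.reducedWeight P *ᵥ x = x ⬝ᵥ G.Q *ᵥ x - 1 / G.γ ^ 2 * (c ⬝ᵥ c) := by
    simp only [reducedWeight, sub_mulVec, smul_mulVec, ← mulVec_mulVec, dotProduct_sub,
      dotProduct_smul, smul_eq_mul, ← hc]
    rw [dotProduct_mulVec_eq P, hP, dotProduct_mulVec_eq G.Bw, ← hc]
  rw [runningCost, hL, hS]
  simp only [smul_dotProduct, dotProduct_smul, smul_eq_mul]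
  field_simp
  ring

lemma quadForm_pos {k : ℕ} {M : Matrix (Fin k) (Fin k) ℝ} (hM : M.PosDef) {x : Fin k → ℝ}
    (hx : x ≠ 0) : 0 < x ⬝ᵥ M *ᵥ x := by
  simpa using hM.dotProduct_mulVec_pos hx

lemma quadForm_nonneg {k : ℕ} {M : Matrix (Fin k) (Fin k) ℝ} (hM : M.PosSemidef) (x : Fin k → ℝ) :
    0 ≤ x ⬝ᵥ M *ᵥ x := by
  simpa using hM.dotProduct_mulVec_nonneg x

/-- Dissipation under the saddle-point control: up to a multiple of the squared deviation of the
disturbance from its saddle-point policy, the storage function decays at a rate that is positive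
definite in the state. -/
lemma exists_dissipation (hγ : 0 < G.γ) (hR : G.R.PosDef) (hP : Pᵀ = P)
    (hARE : G.riccati P = 0) (hreg : (G.reducedWeight P).PosDef) :
    ∃ K : ℝ, 0 ≤ K ∧ ∀ (x : Fin n → ℝ) (w : Fin p → ℝ),
      1 / 2 * (x ⬝ᵥ G.reducedWeight P *ᵥ x)
          + (w - G.disturbanceGain P *ᵥ x) ⬝ᵥ (w - G.disturbanceGain P *ᵥ x)
        ≤ K * ((w - G.disturbanceGain P *ᵥ x) ⬝ᵥ (w - G.disturbanceGain P *ᵥ x))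
          - G.storageRate P x (G.controlGain P *ᵥ x) w := by
  obtain ⟨C₀, hC₀, hbound⟩ := exists_abs_le_mul_of_homogeneous
    (g := fun x => x ⬝ᵥ G.reducedWeight P *ᵥ x)
    (h := fun x => (G.γ ^ 2 • (G.disturbanceGain P *ᵥ x)) ⬝ᵥ
      (G.γ ^ 2 • (G.disturbanceGain P *ᵥ x))) (by fun_prop) (by fun_prop)
    (fun c z => by
      simp only [mulVec_smul, smul_dotProduct, dotProduct_smul, smul_eq_mul]; ring)
    (fun c z => by
      simp only [mulVec_smul, smul_dotProduct, dotProduct_smul, smul_eq_mul]; ring)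
    (fun z hz => quadForm_pos hreg hz)
  have hC : 0 < C₀ + 1 := by positivity
  refine ⟨2 * (C₀ + 1) + 1, by positivity, fun x w => ?_⟩
  set l := G.disturbanceGain P *ᵥ x with hl
  set v := w - l with hv
  set k := G.controlGain P *ᵥ x with hk
  set a := G.γ ^ 2 • l with ha
  have hw : w = l + v := by simp [hv]
  have h1 := storageRate_add_runningCost hγ hR hP hARE x k w
  simp only [← hk, ← hl, ← hv, sub_self, mulVec_zero, dotProduct_zero] at h1
  have h2 : G.runningCost x k w
      = G.runningCost x k l - (2 * (a ⬝ᵥ v) + G.γ ^ 2 * (v ⬝ᵥ v)) := by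
    simp only [runningCost, hw, ha, dotProduct_add, add_dotProduct, smul_dotProduct, smul_eq_mul,
      dotProduct_comm v l]
    ring
  have h3 := runningCost_disturbanceGain (G := G) hγ hP x k
  rw [← hl] at h3
  have h4 : 0 ≤ k ⬝ᵥ G.R *ᵥ k := quadForm_nonneg hR.posSemidef k
  have hS : 0 ≤ x ⬝ᵥ G.reducedWeight P *ᵥ x := quadForm_nonneg hreg.posSemidef x
  have h5 : a ⬝ᵥ a ≤ (C₀ + 1) * (x ⬝ᵥ G.reducedWeight P *ᵥ x) := by
    have := (le_abs_self _).trans (hbound x)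
    simp only [← hl, ← ha] at this
    linarith
  -- Young's inequality for the cross term `2 a · v`
  have h6 : 2 * (a ⬝ᵥ v)
      ≤ 1 / 2 * (x ⬝ᵥ G.reducedWeight P *ᵥ x) + 2 * (C₀ + 1) * (v ⬝ᵥ v) := by
    have h := dotProduct_self_nonneg_real (a - (2 * (C₀ + 1)) • v)
    simp only [sub_dotProduct, dotProduct_sub, smul_dotProduct, dotProduct_smul, smul_eq_mul,
      dotProduct_comm v a] at h
    refine le_of_mul_le_mul_left (a := 2 * (C₀ + 1)) ?_ (by positivity)
    nlinarith
  linarith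

end Algebra

end LQGame

/-! ### Trajectories and their costs -/

namespace LQGame

variable {n m p : ℕ} {G : LQGame n m p} {P : Matrix (Fin n) (Fin n) ℝ}
  {x₀ : Fin n → ℝ} {μ : Policy n m} {ν : Policy n p} {x : StatePath n}

lemma regularSignal_prod (μ : Policy n m) (ν : Policy n p) (x : StatePath n) :
    RegularSignal fun s : ℝ =>
      (x s.toNNReal, μ.toFun s.toNNReal x, ν.toFun s.toNNReal x) :=
  x.regularSignal.prodMk ((μ.regularSignal x).prodMk (ν.regularSignal x))

lemma regularSignal_drift (G : LQGame n m p) (μ : Policy n m) (ν : Policy n p) (x : StatePath n) :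
    RegularSignal fun s : ℝ =>
      G.drift (x s.toNNReal) (μ.toFun s.toNNReal x) (ν.toFun s.toNNReal x) :=
  (regularSignal_prod μ ν x).comp (g := fun z => G.drift z.1 z.2.1 z.2.2)
    (by unfold drift; fun_prop)

lemma regularSignal_storageRate (G : LQGame n m p) (P : Matrix (Fin n) (Fin n) ℝ)
    (μ : Policy n m) (ν : Policy n p) (x : StatePath n) :
    RegularSignal fun s : ℝ =>
      G.storageRate P (x s.toNNReal) (μ.toFun s.toNNReal x) (ν.toFun s.toNNReal x) :=
  (regularSignal_prod μ ν x).comp (g := fun z => G.storageRate P z.1 z.2.1 z.2.2) (by fun_prop)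

lemma regularSignal_runningCost (G : LQGame n m p)
    (μ : Policy n m) (ν : Policy n p) (x : StatePath n) :
    RegularSignal fun s : ℝ =>
      G.runningCost (x s.toNNReal) (μ.toFun s.toNNReal x) (ν.toFun s.toNNReal x) :=
  (regularSignal_prod μ ν x).comp (g := fun z => G.runningCost z.1 z.2.1 z.2.2) (by fun_prop)

theorem existsUnique_isTrajectory (G : LQGame n m p) (x₀ : Fin n → ℝ) (μ : Policy n m)
    (ν : Policy n p) : ∃! x : StatePath n, G.IsTrajectory x₀ μ ν x := by
  refine existsUnique_causal_integral_equation
    (F := fun t x => G.drift (x t) (μ.toFun t x) (ν.toFun t x))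
    (fun x => regularSignal_drift G μ ν x) (fun T => ?_) x₀
  obtain ⟨La, ha⟩ := (linearPolicy G.A).lipschitz T
  obtain ⟨Lu, hu⟩ := μ.lipschitz T
  obtain ⟨Lw, hw⟩ := ν.lipschitz T
  let b := LinearMap.toContinuousLinearMap G.B.mulVecLin
  let c := LinearMap.toContinuousLinearMap G.Bw.mulVecLin
  refine ⟨La + ‖b‖₊ * Lu + ‖c‖₊ * Lw, fun t ht x y r h => ?_⟩
  have h1 : ‖G.A *ᵥ x t - G.A *ᵥ y t‖ ≤ La * r := ha t ht x y r h
  have h2 : ‖b (μ.toFun t x - μ.toFun t y)‖ ≤ ‖b‖ * (Lu * r) :=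
    (b.le_opNorm _).trans (mul_le_mul_of_nonneg_left (hu t ht x y r h) (norm_nonneg _))
  have h3 : ‖c (ν.toFun t x - ν.toFun t y)‖ ≤ ‖c‖ * (Lw * r) :=
    (c.le_opNorm _).trans (mul_le_mul_of_nonneg_left (hw t ht x y r h) (norm_nonneg _))
  have heq : G.drift (x t) (μ.toFun t x) (ν.toFun t x) - G.drift (y t) (μ.toFun t y) (ν.toFun t y)
      = (G.A *ᵥ x t - G.A *ᵥ y t) + b (μ.toFun t x - μ.toFun t y)
        + c (ν.toFun t x - ν.toFun t y) := by
    simp only [drift, b, c, map_sub, LinearMap.coe_toContinuousLinearMap', mulVecLin_apply]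
    abel
  rw [heq]
  refine (norm_add₃_le).trans ?_
  push_cast
  linarith

lemma IsTrajectory.apply_zero (hx : G.IsTrajectory x₀ μ ν x) : x 0 = x₀ := by
  simpa using hx 0

/-- The storage function `xᵀ P x` is the integral of its rate. The trajectory is differentiable
only where the inputs are continuous, so the fundamental theorem of calculus is used with
countably many exceptional times. -/
lemma IsTrajectory.storage_eq (hx : G.IsTrajectory x₀ μ ν x) (P : Matrix (Fin n) (Fin n) ℝ)
    {T : ℝ} (hT : 0 ≤ T) :
    x T.toNNReal ⬝ᵥ P *ᵥ x T.toNNReal = x₀ ⬝ᵥ P *ᵥ x₀ + ∫ s in (0 : ℝ)..T,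
      G.storageRate P (x s.toNNReal) (μ.toFun s.toNNReal x) (ν.toFun s.toNNReal x) := by
  have hf := regularSignal_drift G μ ν x
  have h := MeasureTheory.integral_eq_of_hasDerivAt_off_countable_of_le
    (fun s : ℝ => x s.toNNReal ⬝ᵥ P *ᵥ x s.toNNReal)
    (fun s => G.storageRate P (x s.toNNReal) (μ.toFun s.toNNReal x) (ν.toFun s.toNNReal x))
    hT hf.countable (Continuous.continuousOn (by fun_prop)) (fun t ht => ?_)
    ((regularSignal_storageRate G P μ ν x).intervalIntegrable 0 T)
  · rw [h, Real.toNNReal_zero, hx.apply_zero]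
    ring
  · have hc : ContinuousAt (fun s : ℝ =>
        G.drift (x s.toNNReal) (μ.toFun s.toNNReal x) (ν.toFun s.toNNReal x)) t := by
      by_contra hc
      exact ht.2 ⟨ht.1.1, hc⟩
    have hd : HasDerivAt (fun s : ℝ => x s.toNNReal)
        (G.drift (x t.toNNReal) (μ.toFun t.toNNReal x) (ν.toFun t.toNNReal x)) t := by
      refine ((hf.hasDerivAt_integral hc).const_add x₀).congr_of_eventuallyEq ?_
      filter_upwards [lt_mem_nhds ht.1.1] with s hs
      have := hx s.toNNReal
      rwa [Real.coe_toNNReal s hs.le] at this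
    exact hd.dotProduct_mulVec P

/-- Completion of squares along a trajectory: the cost accumulated up to time `T` is the storage
released so far, plus the penalty for deviating from the saddle-point control, minus the penalty
for deviating from the saddle-point disturbance. -/
lemma IsTrajectory.costUpTo_eq (hx : G.IsTrajectory x₀ μ ν x) (hγ : 0 < G.γ) (hR : G.R.PosDef)
    (hP : Pᵀ = P) (hARE : G.riccati P = 0) (T : ℝ≥0) :
    G.costUpTo μ ν x T = x₀ ⬝ᵥ P *ᵥ x₀ - x T ⬝ᵥ P *ᵥ x T + ∫ s in (0 : ℝ)..T,
      ((μ.toFun s.toNNReal x - G.controlGain P *ᵥ x s.toNNReal) ⬝ᵥ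
          G.R *ᵥ (μ.toFun s.toNNReal x - G.controlGain P *ᵥ x s.toNNReal)
        - G.γ ^ 2 * ((ν.toFun s.toNNReal x - G.disturbanceGain P *ᵥ x s.toNNReal) ⬝ᵥ
          (ν.toFun s.toNNReal x - G.disturbanceGain P *ᵥ x s.toNNReal))) := by
  have h := hx.storage_eq P T.coe_nonneg
  rw [Real.toNNReal_coe] at h
  simp only [← storageRate_add_runningCost hγ hR hP hARE]
  rw [intervalIntegral.integral_add
    ((regularSignal_storageRate G P μ ν x).intervalIntegrable _ _)
    ((regularSignal_runningCost G μ ν x).intervalIntegrable _ _), h, costUpTo]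
  ring

lemma regularSignal_storage (P : Matrix (Fin n) (Fin n) ℝ) (x : StatePath n) :
    RegularSignal fun s : ℝ => x s.toNNReal ⬝ᵥ P *ᵥ x s.toNNReal :=
  x.regularSignal.comp (g := fun z => z ⬝ᵥ P *ᵥ z) (by fun_prop)

lemma cost_eq_of_hasCost {c : EReal} (d : Policy n m → Policy n p → EReal)
    (h : G.HasCost x₀ μ ν c) : G.cost d x₀ μ ν = c := by
  have hex : ∃ c, G.HasCost x₀ μ ν c := ⟨c, h⟩
  rw [cost, dif_pos hex]
  obtain ⟨x, hx, hxc⟩ := h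
  obtain ⟨y, hy, hyc⟩ := hex.choose_spec
  obtain rfl := (existsUnique_isTrajectory G x₀ μ ν).unique hx hy
  exact tendsto_nhds_unique hyc hxc

/-- Against the saddle-point control, every disturbance has a cost, and it is at most `x₀ᵀ P x₀`.
If the deviation from the saddle-point disturbance is not square integrable, the cost is `-∞`;
otherwise dissipation drives the state to zero and the cost converges. -/
theorem exists_hasCost_controlGain_le (hγ : 0 < G.γ) (hR : G.R.PosDef) (hP : P.PosSemidef)
    (hARE : G.riccati P = 0) (hreg : (G.reducedWeight P).PosDef) (x₀ : Fin n → ℝ)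
    (ν : Policy n p) :
    ∃ c, G.HasCost x₀ (linearPolicy (G.controlGain P)) ν c ∧
      c ≤ ((x₀ ⬝ᵥ P *ᵥ x₀ : ℝ) : EReal) := by
  have hPT : Pᵀ = P := by simpa using hP.isHermitian.eq
  obtain ⟨x, hx, -⟩ := existsUnique_isTrajectory G x₀ (linearPolicy (G.controlGain P)) ν
  set v : ℝ → Fin p → ℝ := fun s => ν.toFun s.toNNReal x - G.disturbanceGain P *ᵥ x s.toNNReal
    with hv
  have hcost : ∀ T, G.costUpTo (linearPolicy (G.controlGain P)) ν x T
      = x₀ ⬝ᵥ P *ᵥ x₀ - x T ⬝ᵥ P *ᵥ x T - G.γ ^ 2 * ∫ s in (0 : ℝ)..T, v s ⬝ᵥ v s := by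
    intro T
    rw [hx.costUpTo_eq hγ hR hPT hARE, ← intervalIntegral.integral_const_mul]
    simp [linearPolicy, hv, sub_eq_add_neg]
  have hxw := x.regularSignal.prodMk (ν.regularSignal x)
  have hvv : RegularSignal fun s => v s ⬝ᵥ v s :=
    hxw.comp (g := fun z => (z.2 - G.disturbanceGain P *ᵥ z.1) ⬝ᵥ
      (z.2 - G.disturbanceGain P *ᵥ z.1)) (by fun_prop)
  rcases hvv.integral_tendsto_atTop_or_bounded fun s => dotProduct_self_nonneg_real _ with
    hinf | ⟨l, hl, hle⟩
  · refine ⟨⊥, ⟨x, hx, EReal.tendsto_coe_nhds_bot_iff.2 ?_⟩, bot_le⟩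
    have h1 : Tendsto (fun T : ℝ≥0 => x₀ ⬝ᵥ P *ᵥ x₀ - G.γ ^ 2 * ∫ s in (0 : ℝ)..T, v s ⬝ᵥ v s)
        atTop atBot := by
      simp only [sub_eq_add_neg]
      exact tendsto_atBot_add_const_left _ _
        (tendsto_neg_atTop_atBot.comp (hinf.const_mul_atTop (by positivity)))
    refine tendsto_atBot_mono (fun T => ?_) h1
    rw [hcost]
    linarith [quadForm_nonneg hP (x T)]
  · obtain ⟨K, hK, hdis⟩ := exists_dissipation hγ hR hPT hARE hreg
    let g : (Fin n → ℝ) × (Fin p → ℝ) → ℝ := fun z =>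
      1 / 2 * (z.1 ⬝ᵥ G.reducedWeight P *ᵥ z.1)
        + (z.2 - G.disturbanceGain P *ᵥ z.1) ⬝ᵥ (z.2 - G.disturbanceGain P *ᵥ z.1)
    have hgc : Continuous g := by fun_prop
    have hg2 : ∀ (c : ℝ) z, g (c • z) = c ^ 2 * g z := by
      intro c z
      simp only [g, Prod.smul_fst, Prod.smul_snd, mulVec_smul, ← smul_sub, smul_dotProduct,
        dotProduct_smul, smul_eq_mul]
      ring
    have hgpos : ∀ z, z ≠ 0 → 0 < g z := by
      rintro ⟨y, w⟩ hz
      have hw0 := dotProduct_self_nonneg_real (w - G.disturbanceGain P *ᵥ y)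
      by_cases hy : y = 0
      · subst hy
        have hw : w ≠ 0 := fun h => hz (by simp [h])
        have : 0 < w ⬝ᵥ w := by
          simpa using dotProduct_star_self_pos_iff.2 hw
        simpa [g] using this
      · have := quadForm_pos hreg hy
        simp only [g]
        linarith
    have hg0 : ∀ z, 0 ≤ g z := fun z => by
      have h1 := quadForm_nonneg hreg.posSemidef z.1
      have h2 := dotProduct_self_nonneg_real (z.2 - G.disturbanceGain P *ᵥ z.1)
      simp only [g]
      linarith
    obtain ⟨C, -, hVg⟩ := exists_abs_le_mul_of_homogeneous (g := g)
      (h := fun z => z.1 ⬝ᵥ P *ᵥ z.1) hgc (by fun_prop) hg2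
      (fun c z => by
        simp only [Prod.smul_fst, mulVec_smul, smul_dotProduct, dotProduct_smul, smul_eq_mul]
        ring) hgpos
    obtain ⟨C', -, hDg⟩ := exists_abs_le_mul_of_homogeneous (g := g)
      (h := fun z => G.storageRate P z.1 (G.controlGain P *ᵥ z.1) z.2) hgc (by fun_prop) hg2
      (fun c z => by
        simp only [Prod.smul_fst, Prod.smul_snd, mulVec_smul, storageRate_smul]) hgpos
    have hD := regularSignal_storageRate G P (linearPolicy (G.controlGain P)) ν x
    have hgreg := hxw.comp hgc
    have hlim := tendsto_zero_of_dominated (regularSignal_storage P x) hD hgreg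
      (fun T hT => by
        rw [hx.storage_eq P hT, Real.toNNReal_zero, hx.apply_zero])
      (fun s => hVg (x s.toNNReal, ν.toFun s.toNNReal x))
      (fun s => hDg (x s.toNNReal, ν.toFun s.toNNReal x)) (fun s => hg0 _)
      (M := K * l + x₀ ⬝ᵥ P *ᵥ x₀) (fun T => by
        have hst := hx.storage_eq P T.coe_nonneg
        rw [Real.toNNReal_coe] at hst
        calc ∫ s in (0 : ℝ)..T, g (x s.toNNReal, ν.toFun s.toNNReal x)
            ≤ ∫ s in (0 : ℝ)..T, (K * (v s ⬝ᵥ v s) - G.storageRate P (x s.toNNReal)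
                ((linearPolicy (G.controlGain P)).toFun s.toNNReal x)
                (ν.toFun s.toNNReal x)) :=
              intervalIntegral.integral_mono_on T.2 (hgreg.intervalIntegrable _ _)
                (((hvv.intervalIntegrable _ _).const_mul K).sub (hD.intervalIntegrable _ _))
                fun s _ => hdis _ _
          _ = K * (∫ s in (0 : ℝ)..T, v s ⬝ᵥ v s)
                + (x₀ ⬝ᵥ P *ᵥ x₀ - x T ⬝ᵥ P *ᵥ x T) := by
              rw [intervalIntegral.integral_sub ((hvv.intervalIntegrable _ _).const_mul K)
                (hD.intervalIntegrable _ _), intervalIntegral.integral_const_mul, hst]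
              ring
          _ ≤ K * l + x₀ ⬝ᵥ P *ᵥ x₀ := by
              have h1 := mul_le_mul_of_nonneg_left (hle T) hK
              linarith [quadForm_nonneg hP (x T)])
    have hxT : Tendsto (fun T : ℝ≥0 => x T ⬝ᵥ P *ᵥ x T) atTop (𝓝 0) := by
      have := hlim.comp (NNReal.tendsto_coe_atTop.2 tendsto_id)
      simpa [Function.comp_def] using this
    have hl0 : 0 ≤ l := by simpa using hle 0
    refine ⟨((x₀ ⬝ᵥ P *ᵥ x₀ - 0 - G.γ ^ 2 * l : ℝ) : EReal), ⟨x, hx, ?_⟩, ?_⟩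
    · have h := (hxT.const_sub (x₀ ⬝ᵥ P *ᵥ x₀)).sub (hl.const_mul (G.γ ^ 2))
      simp only [← hcost] at h
      exact (continuous_coe_real_ereal.tendsto _).comp h
    · rw [EReal.coe_le_coe_iff]
      have : 0 ≤ G.γ ^ 2 * l := by positivity
      linarith

/-- Against the saddle-point disturbance, every control has a cost, and it is at least
`x₀ᵀ P x₀`. The running cost is then positive definite in state and control: either its integral
diverges to `+∞`, or state and control are square integrable, which drives the state to zero. -/
theorem exists_hasCost_disturbanceGain_ge (hγ : 0 < G.γ) (hR : G.R.PosDef) (hP : P.PosSemidef)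
    (hARE : G.riccati P = 0) (hreg : (G.reducedWeight P).PosDef) (x₀ : Fin n → ℝ)
    (μ : Policy n m) :
    ∃ c, G.HasCost x₀ μ (linearPolicy (G.disturbanceGain P)) c ∧
      ((x₀ ⬝ᵥ P *ᵥ x₀ : ℝ) : EReal) ≤ c := by
  have hPT : Pᵀ = P := by simpa using hP.isHermitian.eq
  obtain ⟨x, hx, -⟩ := existsUnique_isTrajectory G x₀ μ (linearPolicy (G.disturbanceGain P))
  let g : (Fin n → ℝ) × (Fin m → ℝ) → ℝ := fun z =>
    G.runningCost z.1 z.2 (G.disturbanceGain P *ᵥ z.1)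
  have hg_eq : ∀ z, g z = z.1 ⬝ᵥ G.reducedWeight P *ᵥ z.1 + z.2 ⬝ᵥ G.R *ᵥ z.2 := fun z =>
    runningCost_disturbanceGain hγ hPT z.1 z.2
  have hgc : Continuous g := by fun_prop
  have hg2 : ∀ (c : ℝ) z, g (c • z) = c ^ 2 * g z := by
    intro c z
    simp only [hg_eq, Prod.smul_fst, Prod.smul_snd, mulVec_smul, smul_dotProduct,
      dotProduct_smul, smul_eq_mul]
    ring
  have hg0 : ∀ z, 0 ≤ g z := fun z => by
    rw [hg_eq]
    exact add_nonneg (quadForm_nonneg hreg.posSemidef _) (quadForm_nonneg hR.posSemidef _)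
  have hgpos : ∀ z, z ≠ 0 → 0 < g z := by
    rintro ⟨y, u⟩ hz
    rw [hg_eq]
    by_cases hy : y = 0
    · have hu : u ≠ 0 := fun h => hz (by simp [h, hy])
      exact add_pos_of_nonneg_of_pos (quadForm_nonneg hreg.posSemidef _) (quadForm_pos hR hu)
    · exact add_pos_of_pos_of_nonneg (quadForm_pos hreg hy) (quadForm_nonneg hR.posSemidef _)
  have hgreg : RegularSignal fun s : ℝ => g (x s.toNNReal, μ.toFun s.toNNReal x) :=
    (x.regularSignal.prodMk (μ.regularSignal x)).comp hgc
  have hcost_def : ∀ T, G.costUpTo μ (linearPolicy (G.disturbanceGain P)) x T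
      = ∫ s in (0 : ℝ)..T, g (x s.toNNReal, μ.toFun s.toNNReal x) := fun T => rfl
  rcases hgreg.integral_tendsto_atTop_or_bounded fun s => hg0 _ with hinf | ⟨l, hl, hle⟩
  · exact ⟨⊤, ⟨x, hx, EReal.tendsto_coe_nhds_top_iff.2 hinf⟩, le_top⟩
  · obtain ⟨C, -, hVg⟩ := exists_abs_le_mul_of_homogeneous (g := g)
      (h := fun z => z.1 ⬝ᵥ P *ᵥ z.1) hgc (by fun_prop) hg2
      (fun c z => by
        simp only [Prod.smul_fst, mulVec_smul, smul_dotProduct, dotProduct_smul, smul_eq_mul]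
        ring) hgpos
    obtain ⟨C', -, hDg⟩ := exists_abs_le_mul_of_homogeneous (g := g)
      (h := fun z => G.storageRate P z.1 z.2 (G.disturbanceGain P *ᵥ z.1)) hgc (by fun_prop) hg2
      (fun c z => by
        simp only [Prod.smul_fst, Prod.smul_snd, mulVec_smul, storageRate_smul]) hgpos
    have hlim := tendsto_zero_of_dominated (regularSignal_storage P x)
      (regularSignal_storageRate G P μ (linearPolicy (G.disturbanceGain P)) x) hgreg
      (fun T hT => by
        rw [hx.storage_eq P hT, Real.toNNReal_zero, hx.apply_zero])
      (fun s => hVg (x s.toNNReal, μ.toFun s.toNNReal x))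
      (fun s => hDg (x s.toNNReal, μ.toFun s.toNNReal x)) (fun s => hg0 _) hle
    have hxT : Tendsto (fun T : ℝ≥0 => x T ⬝ᵥ P *ᵥ x T) atTop (𝓝 0) := by
      have := hlim.comp (NNReal.tendsto_coe_atTop.2 tendsto_id)
      simpa [Function.comp_def] using this
    refine ⟨l, ⟨x, hx, (continuous_coe_real_ereal.tendsto _).comp hl⟩, ?_⟩
    rw [EReal.coe_le_coe_iff]
    refine le_of_tendsto_of_tendsto' (f := fun T : ℝ≥0 => x₀ ⬝ᵥ P *ᵥ x₀ - x T ⬝ᵥ P *ᵥ x T)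
      (by simpa using hxT.const_sub (x₀ ⬝ᵥ P *ᵥ x₀)) hl fun T => ?_
    rw [← hcost_def, hx.costUpTo_eq hγ hR hPT hARE]
    refine le_add_of_nonneg_right (intervalIntegral.integral_nonneg T.2 fun s _ => ?_)
    simpa [linearPolicy] using quadForm_nonneg hR.posSemidef
      (μ.toFun s.toNNReal x - G.controlGain P *ᵥ x s.toNNReal)

end LQGame

theorem theorem1 {n m p : ℕ} (G : LQGame n m p) (hγ : 0 < G.γ) (hQ : G.Q.PosDef) (hR : G.R.PosDef)
    (P : Matrix (Fin n) (Fin n) ℝ) (hP : P.PosSemidef) (hARE : G.riccati P = 0)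
    (hstab : IsHurwitz
      (G.A - G.B * G.R⁻¹ * G.Bᵀ * P + (1 / G.γ ^ 2) • (G.Bw * G.Bwᵀ * P)))
    (hreg : (G.Q - (1 / G.γ ^ 2) • (P * G.Bw * G.Bwᵀ * P)).PosDef) :
    -- every pair of policies generates exactly one state trajectory
    (∀ (x₀ : Fin n → ℝ) (μ : Policy n m) (ν : Policy n p),
      ∃! x : StatePath n, G.IsTrajectory x₀ μ ν x) ∧
    -- values and saddle point, under every convention for non-existing improper integrals
    (∀ (d : Policy n m → Policy n p → EReal) (x₀ : Fin n → ℝ),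
      G.lowerValue d x₀ = ((x₀ ⬝ᵥ P *ᵥ x₀ : ℝ) : EReal) ∧
      G.upperValue d x₀ = ((x₀ ⬝ᵥ P *ᵥ x₀ : ℝ) : EReal) ∧
      G.IsSaddlePoint d x₀
        (linearPolicy (-(G.R⁻¹ * G.Bᵀ * P))) (linearPolicy ((1 / G.γ ^ 2) • (G.Bwᵀ * P)))) := by
  refine ⟨G.existsUnique_isTrajectory, fun d x₀ => ?_⟩
  change _ ∧ _ ∧ G.IsSaddlePoint d x₀ (linearPolicy (G.controlGain P))
    (linearPolicy (G.disturbanceGain P))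
  have hle : ∀ ν, G.cost d x₀ (linearPolicy (G.controlGain P)) ν
      ≤ ((x₀ ⬝ᵥ P *ᵥ x₀ : ℝ) : EReal) := fun ν => by
    obtain ⟨c, hc, h⟩ := LQGame.exists_hasCost_controlGain_le hγ hR hP hARE hreg x₀ ν
    rwa [LQGame.cost_eq_of_hasCost d hc]
  have hge : ∀ μ, ((x₀ ⬝ᵥ P *ᵥ x₀ : ℝ) : EReal)
      ≤ G.cost d x₀ μ (linearPolicy (G.disturbanceGain P)) := fun μ => by
    obtain ⟨c, hc, h⟩ := LQGame.exists_hasCost_disturbanceGain_ge hγ hR hP hARE hreg x₀ μ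
    rwa [LQGame.cost_eq_of_hasCost d hc]
  have hsaddle := le_antisymm (hle (linearPolicy (G.disturbanceGain P)))
    (hge (linearPolicy (G.controlGain P)))
  have hlow : ((x₀ ⬝ᵥ P *ᵥ x₀ : ℝ) : EReal) ≤ G.lowerValue d x₀ :=
    (le_iInf hge).trans (le_iSup (fun ν => ⨅ μ, G.cost d x₀ μ ν) _)
  have hupp : G.upperValue d x₀ ≤ ((x₀ ⬝ᵥ P *ᵥ x₀ : ℝ) : EReal) :=
    (iInf_le (fun μ => ⨆ ν, G.cost d x₀ μ ν) _).trans (iSup_le hle)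
  have hlu : G.lowerValue d x₀ ≤ G.upperValue d x₀ := iSup_iInf_le_iInf_iSup _
  have hlow' := le_antisymm (hlu.trans hupp) hlow
  have hupp' := le_antisymm hupp (hlow.trans hlu)
  refine ⟨hlow', hupp', ⟨?_, ?_⟩, ?_, ?_⟩
  · rw [hlow', hsaddle]
  · rw [hupp', hsaddle]
  · rw [hsaddle]; exact hle
  · rw [hsaddle]; exact hge
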